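/- For metric spaces $S,Y$ let $c_Y(S)\in[1,\infty]$ denote the bi-Lipschitz distortion of $S$ in $Y$, i.e. the infimum over those $D\in[1,\infty]$ for which there exist $f:S\to Y$ and $s\in(0,\infty)$ with $s\,d_S(x,y)\le d_Y(f(x),f(y))\le Ds\,d_S(x,y)$ for all $x,y\in S$. For a finite dimensional real Banach space $X$ with closed unit ball $B_X$, a $\delta$-net in $B_X$ is a set $\mathcal N_\delta\subseteq B_X$ such that every point of $B_X$ lies at distance at most $\delta$ from some point of $\mathcal N_\delta$; it is equipped with the metric inherited from $X$. For a real Banach space $Y$ and $\varepsilon\in(0,1)$, the discretization modulus $\delta_{X\hookrightarrow Y}(\varepsilon)$ is the supremum over those $\delta\in(0,1)$ such that every $\delta$-net $\mathcal N_\delta$ in $B_X$ satisfies $c_Y(\mathcal N_\delta)\ge(1-\varepsilon)\,c_Y(X)$. For $p\in[1,\infty)$ let $L_p=L_p([0,1])$ be the real $L_p$ space of Lebesgue measure on $[0,1]$. Then there exists a universal constant $\kappa\in(0,\infty)$ such that for every $p\in[1,\infty)$, every $\varepsilon\in(0,1)$, every integer $n\ge1$ and every $n$-dimensional real Banach space $X$,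 $$\delta_{X\hookrightarrow L_p}(\varepsilon)\ge\frac{\kappa\,\varepsilon^2}{n^{5/2}}.$$ -/

import Mathlib

open MeasureTheory
open scoped NNReal ENNReal

/-- The bi-Lipschitz distortion `c_Y(X) ∈ [1, ∞]` of `X` in `Y`: the infimum over those
`D ∈ [1, ∞]` for which there are `f : X → Y` and `s ∈ (0, ∞)` with
`s * d(x, y) ≤ d(f x, f y) ≤ D * s * d(x, y)` for all `x, y` (with `∞ * 0 = 0`). -/
noncomputable def distortion (X Y : Type*) [MetricSpace X] [MetricSpace Y] : ℝ≥0∞ :=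
  sInf {D : ℝ≥0∞ | 1 ≤ D ∧ ∃ (f : X → Y) (s : ℝ≥0), 0 < s ∧ ∀ x y : X,
    (s : ℝ≥0∞) * edist x y ≤ edist (f x) (f y) ∧
      edist (f x) (f y) ≤ D * (s : ℝ≥0∞) * edist x y}

/-- `N` is a `δ`-net in the closed unit ball `B_X`: a subset of `B_X` such that every point of
`B_X` is within distance at most `δ` of some point of `N`. -/
def IsNetInUnitBall {X : Type*} [NormedAddCommGroup X] (δ : ℝ≥0) (N : Set X) : Prop :=
  N ⊆ Metric.closedBall (0 : X) 1 ∧ Metric.IsCover δ (Metric.closedBall (0 : X) 1) N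

/-- The discretization modulus `δ_{X ↪ Y}(ε)`: the supremum over those `δ ∈ (0, 1)` such that
every `δ`-net `N` in `B_X` satisfies `c_Y(N) ≥ (1 - ε) c_Y(X)`. Here `N` carries the metric
inherited from `X`. The supremum is over a bounded set of reals (and is `0` if it is empty). -/
noncomputable def discretizationModulus (X Y : Type*) [NormedAddCommGroup X]
    [NormedAddCommGroup Y] (ε : ℝ) : ℝ :=
  sSup {δ : ℝ | 0 < δ ∧ δ < 1 ∧ ∀ N : Set X, IsNetInUnitBall δ.toNNReal N →
    ENNReal.ofReal (1 - ε) * distortion X Y ≤ distortion N Y}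

/-- The real Banach space `L_p = L_p([0, 1])` with respect to Lebesgue measure. -/
abbrev LpUnitInterval (p : ℝ≥0∞) : Type :=
  Lp ℝ p (volume.restrict (Set.Icc (0 : ℝ) 1))

/-! Take an embedding of a net into $L_p$ with distortion `D`. John's theorem and a Euclidean copy
in $L_p$ bound the distortion of `X` by `√n`, so only `D < √n` matters. Rounding points of the ball
to a finite subnet extends the embedding to a map `F` that is bi-Lipschitz up to an additive error
of order `δ`. Averaging `F` over balls of radius `τ` gives a Lipschitz map `Φ` into a finite
dimensional subspace, differentiable almost everywhere by Rademacher.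

No single good derivative is selected. All of them are used at once: `x ↦ ((y, t) ↦ (Φ'(y) x)(t))`
maps `X` into an `L_p` space of a product, which embeds isometrically into $L_p([0,1])$
(`exists_Lp_prod_of_field`, `exists_linearIsometry_LpUnitInterval`). The upper estimate uses a bound
on `‖Φ'(y)‖`; the lower one needs only the mean of `‖Φ'(y) x‖` over `y`, since the `L_1` norm is at
most the `L_p` norm.

Both estimates (`norm_ballAverage_sub_le`, `le_setIntegral_norm_fderiv`) rest on one telescoping
argument. Cut a ball `K` of radius `r` into progressions of step `h`. Increments along a progression
add up to the difference of its ends, so an additive error `c` is paid once per progression instead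
of once per step. Progressions are indexed by `K \ (K + h)`, a proportion at most `n‖h‖ / (2r)` of
`K`, so `c` becomes a relative error `cn / (2r)`. It remains to make `Dτn` and `δn / τ` of order
`ε`: with `D ≤ √n` this gives `τ ~ ε / n^(3/2)` and `δ ~ ε² / n^(5/2)`. -/

open Metric Set

/-! ### Telescoping along arithmetic progressions in a convex body -/

section Orbits

variable {E : Type*} [NormedAddCommGroup E] [NormedSpace ℝ E]

/-- The points of `K` that are not in the translate `K + h`. -/
def entrySet (K : Set E) (h : E) : Set E := {z | z ∈ K ∧ z - h ∉ K}

/-- The sum of `φ` over the points of the arithmetic progression `z, z + h, …, z + (M - 1) h`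
which lie in `K`. -/
noncomputable def orbitSum {V : Type*} [AddCommMonoid V] (K : Set E) (h : E) (M : ℕ) (φ : E → V)
    (z : E) : V :=
  ∑ j ∈ Finset.range M, K.indicator φ (z + (j : ℝ) • h)

theorem Convex.add_natCast_smul_mem {K : Set E} (hK : Convex ℝ K) {z h : E} {i j : ℕ} (hz : z ∈ K)
    (hj : z + (j : ℝ) • h ∈ K) (hij : i ≤ j) : z + (i : ℝ) • h ∈ K := by
  rcases Nat.eq_zero_or_pos j with rfl | hj0
  · obtain rfl : i = 0 := by omega
    exact hj
  have hj' : (0 : ℝ) < j := by exact_mod_cast hj0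
  have := hK.add_smul_mem hz hj (t := (i : ℝ) / j)
    ⟨by positivity, (div_le_one hj').2 (by exact_mod_cast hij)⟩
  rwa [smul_smul, div_mul_cancel₀ _ hj'.ne'] at this

/-- By convexity a progression that has left `K` never returns, so its part in `K` is an initial
segment and sums over it telescope. -/
theorem exists_orbit_exit {K : Set E} (hK : Convex ℝ K) {h : E} {M : ℕ}
    (hM : ∀ z ∈ K, z + (M : ℝ) • h ∉ K) {z : E} (hz : z ∈ K) :
    ∃ k ≤ M, 0 < k ∧ (∀ j < k, z + (j : ℝ) • h ∈ K) ∧ ∀ j, k ≤ j → z + (j : ℝ) • h ∉ K := by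
  classical
  have hex : ∃ k : ℕ, z + (k : ℝ) • h ∉ K := ⟨M, hM z hz⟩
  refine ⟨Nat.find hex, Nat.find_min' hex (hM z hz), ?_, fun j hj => ?_, fun j hj hjK => ?_⟩
  · rw [Nat.find_pos]
    simpa using hz
  · simpa using Nat.find_min hex hj
  · exact Nat.find_spec hex (hK.add_natCast_smul_mem hz hjK hj)

theorem orbitSum_eq_sum {V : Type*} [AddCommMonoid V] {K : Set E} {h : E} {M k : ℕ} (hk : k ≤ M)
    {z : E} (h1 : ∀ j < k, z + (j : ℝ) • h ∈ K) (h2 : ∀ j, k ≤ j → z + (j : ℝ) • h ∉ K)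
    (φ : E → V) : orbitSum K h M φ z = ∑ j ∈ Finset.range k, φ (z + (j : ℝ) • h) := by
  rw [orbitSum, ← Finset.sum_subset (Finset.range_mono hk)]
  · exact Finset.sum_congr rfl fun j hj => indicator_of_mem (h1 j (Finset.mem_range.1 hj)) _
  · intro j _ hj
    exact indicator_of_notMem (h2 j (by simpa using hj)) _

/-- Walking back from `w` in steps of `h`, the last point before leaving `K` is the only one in the
entry set: each point of `K` lies on exactly one orbit. -/
theorem sum_entrySet_indicator {K : Set E} (hK : Convex ℝ K) {h : E} {M : ℕ}
    (hM : ∀ z ∈ K, z - (M : ℝ) • h ∉ K) {w : E} (hw : w ∈ K) :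
    ∑ j ∈ Finset.range M, (entrySet K h).indicator (fun _ => (1 : ℝ)) (w - (j : ℝ) • h) = 1 := by
  obtain ⟨k, hkM, hk0, h1, h2⟩ := exists_orbit_exit hK (h := -h) (M := M)
    (by simpa [sub_eq_add_neg] using hM) hw
  simp only [smul_neg, ← sub_eq_add_neg] at h1 h2
  obtain ⟨k, rfl⟩ : ∃ l, k = l + 1 := ⟨k - 1, by omega⟩
  have key : ∀ j : ℕ, w - (j : ℝ) • h - h = w - ((j + 1 : ℕ) : ℝ) • h := by
    intro j; push_cast; module
  rw [Finset.sum_eq_single_of_mem k (Finset.mem_range.2 (by omega))]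
  · rw [indicator_of_mem]
    exact ⟨h1 k (by omega), by rw [key]; exact h2 _ le_rfl⟩
  · intro j _ hjk
    refine indicator_of_notMem ?_ _
    rintro ⟨ha, hb⟩
    rw [key] at hb
    rcases lt_or_gt_of_ne hjk with hlt | hgt
    · exact hb (h1 _ (by omega))
    · exact h2 _ (by omega) ha

theorem exists_forall_natCast_smul_notMem {K : Set E} (hK : Bornology.IsBounded K) {h : E}
    (hh : h ≠ 0) : ∃ M : ℕ, (∀ z ∈ K, z + (M : ℝ) • h ∉ K) ∧ ∀ z ∈ K, z - (M : ℝ) • h ∉ K := by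
  obtain ⟨C, hC⟩ := isBounded_iff.1 hK
  obtain ⟨M, hM⟩ := exists_nat_gt (C / ‖h‖)
  have hh' : 0 < ‖h‖ := norm_pos_iff.2 hh
  rw [div_lt_iff₀ hh'] at hM
  refine ⟨M, fun z hz hz' => ?_, fun z hz hz' => ?_⟩
  · have := hC hz hz'
    rw [dist_self_add_right, norm_smul, Real.norm_natCast] at this
    linarith
  · have := hC hz hz'
    rw [dist_self_sub_right, norm_smul, Real.norm_natCast] at this
    linarith

variable [MeasurableSpace E] [BorelSpace E] [FiniteDimensional ℝ E] (μ : Measure E)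
  [μ.IsAddHaarMeasure] {V : Type*} [NormedAddCommGroup V] [NormedSpace ℝ V]

omit [NormedSpace ℝ E] [FiniteDimensional ℝ E] in
theorem measurableSet_entrySet {K : Set E} (hK : MeasurableSet K) (h : E) :
    MeasurableSet (entrySet K h) :=
  hK.inter (hK.preimage (measurable_id.sub_const h)).compl

omit [FiniteDimensional ℝ E] [NormedSpace ℝ V] in
theorem integrable_orbitSum {K : Set E} (hKm : MeasurableSet K) {h : E} (M : ℕ) {φ : E → V}
    (hφ : IntegrableOn φ K μ) : Integrable (orbitSum K h M φ) μ := by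
  refine integrable_finsetSum _ fun j _ => ?_
  exact ((integrable_indicator_iff hKm).2 hφ).comp_add_right _

omit [FiniteDimensional ℝ E] in
-- The parts in `K` of the translates of the entry set by multiples of `h` tile `K`; translation
-- invariance of `μ` turns this tiling into an identity of integrals.
theorem setIntegral_orbitSum {K : Set E} (hK : Convex ℝ K) (hKm : MeasurableSet K) {h : E}
    {M : ℕ} (hM : ∀ z ∈ K, z - (M : ℝ) • h ∉ K) {φ : E → V} (hφ : IntegrableOn φ K μ) :
    ∫ z in entrySet K h, orbitSum K h M φ z ∂μ = ∫ z in K, φ z ∂μ := by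
  have hA := measurableSet_entrySet hKm h
  have hi : Integrable (K.indicator φ) μ := (integrable_indicator_iff hKm).2 hφ
  have hterm : ∀ j : ℕ, Integrable (fun w =>
      (entrySet K h).indicator (fun _ => (1 : ℝ)) (w - (j : ℝ) • h) • K.indicator φ w) μ := by
    intro j
    refine hi.bdd_smul ?_ (C := 1) (ae_of_all _ fun w => ?_)
    · exact ((measurable_const.indicator hA).comp
        (measurable_id.sub_const _)).aestronglyMeasurable
    · by_cases hw : w - (j : ℝ) • h ∈ entrySet K h <;> simp [hw]
  calc ∫ z in entrySet K h, orbitSum K h M φ z ∂μ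
      = ∑ j ∈ Finset.range M, ∫ z in entrySet K h, K.indicator φ (z + (j : ℝ) • h) ∂μ :=
        integral_finsetSum _ fun j _ => (hi.comp_add_right _).integrableOn
    _ = ∑ j ∈ Finset.range M, ∫ w,
          (entrySet K h).indicator (fun _ => (1 : ℝ)) (w - (j : ℝ) • h) • K.indicator φ w ∂μ := by
        refine Finset.sum_congr rfl fun j _ => ?_
        rw [← integral_indicator hA, ← integral_add_right_eq_self (μ := μ) (fun w =>
          (entrySet K h).indicator (fun _ => (1 : ℝ)) (w - (j : ℝ) • h) • K.indicator φ w)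
          ((j : ℝ) • h)]
        refine integral_congr_ae (ae_of_all _ fun z => ?_)
        dsimp only
        rw [add_sub_cancel_right]
        by_cases hz : z ∈ entrySet K h <;> simp [hz]
    _ = ∫ w, K.indicator φ w ∂μ := by
        rw [← integral_finsetSum _ fun j _ => hterm j]
        refine integral_congr_ae (ae_of_all _ fun w => ?_)
        dsimp only
        by_cases hw : w ∈ K
        · rw [← Finset.sum_smul, sum_entrySet_indicator hK hM hw, one_smul]
        · simp [hw]
    _ = ∫ z in K, φ z ∂μ := integral_indicator hKm

omit [FiniteDimensional ℝ E] in
theorem setIntegral_orbitSum_one {K : Set E} (hK : Convex ℝ K) (hKm : MeasurableSet K) {h : E}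
    {M : ℕ} (hM : ∀ z ∈ K, z - (M : ℝ) • h ∉ K) (hfin : μ K ≠ ∞) :
    ∫ z in entrySet K h, orbitSum K h M (fun _ => (1 : ℝ)) z ∂μ = μ.real K := by
  rw [setIntegral_orbitSum μ hK hKm hM (integrableOn_const hfin)]
  simp

/-- If `G` is Lipschitz up to an additive error, then so is its average over a convex body, with
the error multiplied by the volume of the symmetric difference with a translate. -/
theorem norm_setIntegral_translate_sub_le {K : Set E} (hK : Convex ℝ K) (hKm : MeasurableSet K)
    (hKb : Bornology.IsBounded K) {h : E} (hh : h ≠ 0) {G : E → V} {D c : ℝ}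
    (hG : IntegrableOn (fun z => G (z + h) - G z) K μ)
    (hGD : ∀ z ∈ K, ∀ w, w - h ∈ K → ‖G w - G z‖ ≤ D * (‖w - z‖ + c)) :
    ‖∫ z in K, (G (z + h) - G z) ∂μ‖ ≤
      D * (‖h‖ * μ.real K + c * μ.real (entrySet K h)) := by
  have hfin : μ K ≠ ∞ := hKb.measure_lt_top.ne
  have hAK : entrySet K h ⊆ K := fun z hz => hz.1
  have hAfin : μ (entrySet K h) ≠ ∞ := (hKb.subset hAK).measure_lt_top.ne
  have hA := measurableSet_entrySet hKm h
  obtain ⟨M, hM1, hM2⟩ := exists_forall_natCast_smul_notMem hKb hh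
  have h1 := integrable_orbitSum μ hKm (h := h) M (integrableOn_const (C := (1 : ℝ)) hfin)
  rw [← setIntegral_orbitSum μ hK hKm hM2 hG]
  calc _ ≤ ∫ z in entrySet K h, D * (‖h‖ * orbitSum K h M (fun _ => (1 : ℝ)) z + c) ∂μ := by
        refine norm_integral_le_of_norm_le ?_ ?_
        · exact (((h1.integrableOn.const_mul _).add (integrableOn_const hAfin))).const_mul _
        refine (ae_restrict_iff' hA).2 (ae_of_all _ fun z hz => ?_)
        obtain ⟨k, hkM, hk0, hk1, hk2⟩ := exists_orbit_exit hK hM1 hz.1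
        rw [orbitSum_eq_sum hkM hk1 hk2, orbitSum_eq_sum hkM hk1 hk2]
        have e : ∀ j : ℕ, z + (j : ℝ) • h + h = z + ((j + 1 : ℕ) : ℝ) • h := by
          intro j; push_cast; module
        simp only [e]
        rw [Finset.sum_range_sub (fun j : ℕ => G (z + (j : ℝ) • h))]
        -- Only the two ends of the orbit survive. The far end lies just outside `K`, which is why
        -- the hypothesis asks for `w - h ∈ K`.
        have := hGD z hz.1 (z + (k : ℝ) • h) (by
          obtain ⟨l, rfl⟩ : ∃ l, k = l + 1 := ⟨k - 1, by omega⟩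
          rw [← e, add_sub_cancel_right]
          exact hk1 l (by omega))
        simpa [norm_smul, mul_comm] using this
    _ = _ := by
        rw [integral_const_mul, integral_add (h1.integrableOn.const_mul _)
          (integrableOn_const hAfin), integral_const_mul,
          setIntegral_orbitSum_one μ hK hKm hM2 hfin]
        simp [mul_comm]

omit [NormedSpace ℝ V] in
/-- If `G` expands distances up to an additive error, then the average displacement of `G` by a
translation in a convex body is at least the displacement of the argument, up to the error
multiplied by the volume of the symmetric difference with a translate. -/
theorem le_setIntegral_norm_translate_sub {K : Set E} (hK : Convex ℝ K) (hKm : MeasurableSet K)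
    (hKb : Bornology.IsBounded K) {h : E} (hh : h ≠ 0) {G : E → V} {c : ℝ}
    (hG : IntegrableOn (fun z => G (z + h) - G z) K μ)
    (hGc : ∀ z ∈ K, ∀ w, w - h ∈ K → ‖w - z‖ - c ≤ ‖G w - G z‖) :
    ‖h‖ * μ.real K - c * μ.real (entrySet K h) ≤ ∫ z in K, ‖G (z + h) - G z‖ ∂μ := by
  have hfin : μ K ≠ ∞ := hKb.measure_lt_top.ne
  have hAK : entrySet K h ⊆ K := fun z hz => hz.1
  have hAfin : μ (entrySet K h) ≠ ∞ := (hKb.subset hAK).measure_lt_top.ne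
  have hA := measurableSet_entrySet hKm h
  obtain ⟨M, hM1, hM2⟩ := exists_forall_natCast_smul_notMem hKb hh
  have h1 := integrable_orbitSum μ hKm (h := h) M (integrableOn_const (C := (1 : ℝ)) hfin)
  rw [← setIntegral_orbitSum μ hK hKm hM2 hG.norm]
  calc _ = ∫ z in entrySet K h, (‖h‖ * orbitSum K h M (fun _ => (1 : ℝ)) z - c) ∂μ := by
        rw [integral_sub (h1.integrableOn.const_mul _)
          (integrableOn_const hAfin), integral_const_mul,
          setIntegral_orbitSum_one μ hK hKm hM2 hfin]
        simp [mul_comm]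
    _ ≤ _ := by
        refine setIntegral_mono_on ?_ ?_ hA fun z hz => ?_
        · exact (h1.integrableOn.const_mul _).sub (integrableOn_const hAfin)
        · exact (integrable_orbitSum μ hKm M hG.norm).integrableOn
        obtain ⟨k, hkM, hk0, hk1, hk2⟩ := exists_orbit_exit hK hM1 hz.1
        rw [orbitSum_eq_sum hkM hk1 hk2, orbitSum_eq_sum hkM hk1 hk2]
        have e : ∀ j : ℕ, z + (j : ℝ) • h + h = z + ((j + 1 : ℕ) : ℝ) • h := by
          intro j; push_cast; module
        simp only [e]
        -- The triangle inequality precedes the telescoping: the steps together are at least as long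
        -- as the distance between the ends.
        refine le_trans ?_ (norm_sum_le _ _)
        rw [Finset.sum_range_sub (fun j : ℕ => G (z + (j : ℝ) • h))]
        have := hGc z hz.1 (z + (k : ℝ) • h) (by
          obtain ⟨l, rfl⟩ : ∃ l, k = l + 1 := ⟨k - 1, by omega⟩
          rw [← e, add_sub_cancel_right]
          exact hk1 l (by omega))
        simpa [norm_smul, mul_comm] using this

/-- The ball of radius `r - ‖h‖ / 2` around `h / 2` lies in both the ball and its translate;
Bernoulli's inequality bounds the volume left over. For `‖h‖ > 2r` the claimed proportion exceeds
one. -/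
theorem measureReal_entrySet_closedBall_le {r : ℝ} (hr : 0 < r) (h : E) :
    μ.real (entrySet (closedBall 0 r) h) ≤
      μ.real (closedBall (0 : E) r) * (Module.finrank ℝ E * ‖h‖ / (2 * r)) := by
  set n := Module.finrank ℝ E
  have hfin : μ (closedBall (0 : E) r) ≠ ∞ := isBounded_closedBall.measure_lt_top.ne
  have hAK : entrySet (closedBall (0 : E) r) h ⊆ closedBall 0 r := fun z hz => hz.1
  rcases lt_or_ge (2 * r) ‖h‖ with hh | hh
  · have : Nontrivial E := ⟨h, 0, norm_pos_iff.1 (by linarith)⟩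
    have hn1 : (1 : ℝ) ≤ n := by exact_mod_cast Module.finrank_pos (R := ℝ) (M := E)
    refine (measureReal_mono hAK hfin).trans (le_mul_of_one_le_right measureReal_nonneg ?_)
    rw [one_le_div (by positivity)]
    nlinarith
  have hsub : closedBall ((1 / 2 : ℝ) • h) (r - ‖h‖ / 2) ⊆
      closedBall (0 : E) r \ entrySet (closedBall 0 r) h := by
    intro z hz
    rw [mem_closedBall, dist_eq_norm] at hz
    have h2 : ‖(1 / 2 : ℝ) • h‖ = ‖h‖ / 2 := by rw [norm_smul]; norm_num; ring
    have a1 : ‖z‖ ≤ r := by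
      have := norm_le_norm_sub_add z ((1 / 2 : ℝ) • h)
      linarith
    have a2 : ‖z - h‖ ≤ r := by
      have := norm_sub_le (z - (1 / 2 : ℝ) • h) ((1 / 2 : ℝ) • h)
      have e : z - (1 / 2 : ℝ) • h - (1 / 2 : ℝ) • h = z - h := by module
      rw [e] at this
      linarith
    exact ⟨by simpa using a1, fun hc => hc.2 (by simpa using a2)⟩
  have hA := measurableSet_entrySet (measurableSet_closedBall (x := (0 : E)) (ε := r)) h
  have key := measureReal_mono (μ := μ) hsub (measure_ne_top_of_subset sdiff_subset hfin)
  rw [measureReal_sdiff hAK hA hfin] at key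
  rw [Measure.addHaar_real_closedBall' μ _ (by linarith)] at key
  have hK : μ.real (closedBall (0 : E) r) = r ^ n * μ.real (closedBall (0 : E) 1) :=
    Measure.addHaar_real_closedBall' μ _ hr.le
  have hB := one_add_mul_le_pow (a := -(‖h‖ / (2 * r))) (by
    have : ‖h‖ / (2 * r) ≤ 1 := (div_le_one (by positivity)).2 hh
    linarith) n
  have hpow : (r - ‖h‖ / 2) ^ n = r ^ n * (1 + -(‖h‖ / (2 * r))) ^ n := by
    rw [← mul_pow]; congr 1; field_simp; ring
  have h3 : μ.real (closedBall (0 : E) r) * (1 + n * -(‖h‖ / (2 * r))) ≤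
      (r - ‖h‖ / 2) ^ n * μ.real (closedBall (0 : E) 1) := by
    rw [hpow, hK, mul_right_comm]
    gcongr
  have : μ.real (closedBall (0 : E) r) * (n * ‖h‖ / (2 * r)) =
      μ.real (closedBall (0 : E) r) -
        μ.real (closedBall (0 : E) r) * (1 + n * -(‖h‖ / (2 * r))) := by ring
  rw [this]
  linarith

end Orbits

/-! ### Smoothing by averages over balls -/

section BallAverage

variable {E : Type*} [NormedAddCommGroup E] [NormedSpace ℝ E] [FiniteDimensional ℝ E]
  [MeasurableSpace E] [BorelSpace E] (μ : Measure E) [μ.IsAddHaarMeasure]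
  {V : Type*} [NormedAddCommGroup V] [NormedSpace ℝ V]

/-- The average of `F` over the closed ball of radius `τ` around `x`. -/
noncomputable def ballAverage (τ : ℝ) (F : E → V) (x : E) : V :=
  ⨍ z in closedBall (0 : E) τ, F (x + z) ∂μ

variable {μ}

omit [NormedSpace ℝ V] in
theorem integrableOn_comp_add_left_of_bounded {F : E → V} (hF : StronglyMeasurable F) {B : ℝ}
    (hB : ∀ x, ‖F x‖ ≤ B) {K : Set E} (hK : Bornology.IsBounded K) (x : E) :
    IntegrableOn (fun z => F (x + z)) K μ :=
  Measure.integrableOn_of_bounded (M := B) hK.measure_lt_top.ne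
    (hF.comp_measurable (measurable_const_add x)).aestronglyMeasurable
    (ae_of_all _ fun _ => hB _)

/-- The two averages differ by the mean of increments of `F` under translation by `x - y`, so
telescoping turns the additive error into a relative one. -/
theorem norm_ballAverage_sub_le {F : E → V} (hF : StronglyMeasurable F) {B : ℝ}
    (hB : ∀ x, ‖F x‖ ≤ B) {R D c : ℝ} (hD : 0 ≤ D) (hc : 0 ≤ c)
    (hFD : ∀ x ∈ closedBall (0 : E) R, ∀ y ∈ closedBall (0 : E) R,
      ‖F x - F y‖ ≤ D * (‖x - y‖ + c)) {τ : ℝ} (hτ : 0 < τ) {x y : E}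
    (hx : x ∈ closedBall (0 : E) (R - τ)) (hy : y ∈ closedBall (0 : E) (R - τ)) :
    ‖ballAverage μ τ F x - ballAverage μ τ F y‖ ≤
      D * (1 + c * Module.finrank ℝ E / (2 * τ)) * ‖x - y‖ := by
  rcases eq_or_ne x y with rfl | hxy
  · simp
  set K := closedBall (0 : E) τ with hK
  set h := x - y with hh
  have hh0 : h ≠ 0 := sub_ne_zero.2 hxy
  have hb : Bornology.IsBounded K := isBounded_closedBall
  have hμ : 0 < μ.real K :=
    ENNReal.toReal_pos (measure_closedBall_pos μ _ hτ).ne' hb.measure_lt_top.ne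
  have i1 := integrableOn_comp_add_left_of_bounded (μ := μ) hF hB hb x
  have i2 := integrableOn_comp_add_left_of_bounded (μ := μ) hF hB hb y
  have e : ∀ z, F (y + (z + h)) = F (x + z) := fun z => by congr 1; rw [hh]; abel
  have key := norm_setIntegral_translate_sub_le μ (convex_closedBall (0 : E) τ)
    measurableSet_closedBall hb hh0 (G := fun z => F (y + z)) (D := D) (c := c)
    (by simp only [e]; exact i1.sub i2) (by
      intro z hz w hw
      have hz' : ‖z‖ ≤ τ := by simpa using hz
      have hw' : ‖w - h‖ ≤ τ := by simpa using hw
      have hx' : ‖x‖ ≤ R - τ := by simpa using hx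
      have hy' : ‖y‖ ≤ R - τ := by simpa using hy
      have := hFD (y + w) (by
        have e2 : y + w = x + (w - h) := by rw [hh]; abel
        rw [e2, mem_closedBall_zero_iff]
        linarith [norm_add_le x (w - h)]) (y + z) (by
        rw [mem_closedBall_zero_iff]
        linarith [norm_add_le y z])
      simpa using this)
  simp only [e] at key
  rw [integral_sub i1 i2] at key
  have hA := measureReal_entrySet_closedBall_le μ hτ h
  rw [ballAverage, ballAverage, setAverage_eq, setAverage_eq, ← smul_sub, norm_smul, norm_inv,
    Real.norm_of_nonneg hμ.le, inv_mul_le_iff₀ hμ]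
  refine key.trans ?_
  calc D * (‖h‖ * μ.real K + c * μ.real (entrySet K h))
      ≤ D * (‖h‖ * μ.real K + c * (μ.real K * (Module.finrank ℝ E * ‖h‖ / (2 * τ)))) := by gcongr
    _ = _ := by ring

theorem norm_ballAverage_sub_self_le [CompleteSpace V] {F : E → V} (hF : StronglyMeasurable F)
    {B : ℝ} (hB : ∀ x, ‖F x‖ ≤ B) {R D c : ℝ} (hD : 0 ≤ D)
    (hFD : ∀ x ∈ closedBall (0 : E) R, ∀ y ∈ closedBall (0 : E) R,
      ‖F x - F y‖ ≤ D * (‖x - y‖ + c)) {τ : ℝ} (hτ : 0 < τ) {x : E}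
    (hx : x ∈ closedBall (0 : E) (R - τ)) :
    ‖ballAverage μ τ F x - F x‖ ≤ D * (τ + c) := by
  have hb : Bornology.IsBounded (closedBall (0 : E) τ) := isBounded_closedBall
  rw [← dist_eq_norm, ← mem_closedBall]
  refine (convex_closedBall (F x) _).set_average_mem isClosed_closedBall
    (measure_closedBall_pos μ _ hτ).ne' hb.measure_lt_top.ne ?_
    (integrableOn_comp_add_left_of_bounded hF hB hb x)
  refine (ae_restrict_iff' measurableSet_closedBall).2 (ae_of_all _ fun z hz => ?_)
  have hz' : ‖z‖ ≤ τ := by simpa using hz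
  have hx' : ‖x‖ ≤ R - τ := by simpa using hx
  rw [mem_closedBall, dist_eq_norm]
  refine (hFD (x + z) ?_ x ?_).trans ?_
  · rw [mem_closedBall_zero_iff]
    linarith [norm_add_le x z]
  · rw [mem_closedBall_zero_iff]
    linarith
  · rw [add_sub_cancel_left]
    gcongr

theorem le_norm_ballAverage_sub [CompleteSpace V] {F : E → V} (hF : StronglyMeasurable F)
    {B : ℝ} (hB : ∀ x, ‖F x‖ ≤ B) {R D c : ℝ} (hD : 0 ≤ D)
    (hFD : ∀ x ∈ closedBall (0 : E) R, ∀ y ∈ closedBall (0 : E) R,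
      ‖F x - F y‖ ≤ D * (‖x - y‖ + c))
    (hFc : ∀ x ∈ closedBall (0 : E) R, ∀ y ∈ closedBall (0 : E) R,
      ‖x - y‖ - c ≤ ‖F x - F y‖) {τ : ℝ} (hτ : 0 < τ) {x y : E}
    (hx : x ∈ closedBall (0 : E) (R - τ)) (hy : y ∈ closedBall (0 : E) (R - τ)) :
    ‖x - y‖ - (c + 2 * (D * (τ + c))) ≤ ‖ballAverage μ τ F x - ballAverage μ τ F y‖ := by
  have h1 := norm_ballAverage_sub_self_le (μ := μ) hF hB hD hFD hτ hx
  have h2 := norm_ballAverage_sub_self_le (μ := μ) hF hB hD hFD hτ hy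
  have hR : closedBall (0 : E) (R - τ) ⊆ closedBall 0 R := closedBall_subset_closedBall (by linarith)
  have h3 := hFc x (hR hx) y (hR hy)
  set a := ballAverage μ τ F x
  set b := ballAverage μ τ F y
  have h4 : ‖F x - F y‖ ≤ ‖a - F x‖ + ‖a - b‖ + ‖b - F y‖ := by
    have e : F x - F y = -(a - F x) + (a - b) + (b - F y) := by abel
    rw [e]
    refine (norm_add₃_le).trans ?_
    rw [norm_neg]
  linarith

end BallAverage

/-! ### Derivatives bounded below on average -/

section AverageDerivative

variable {E : Type*} [NormedAddCommGroup E] [NormedSpace ℝ E] [FiniteDimensional ℝ E]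
  [MeasurableSpace E] [BorelSpace E] {μ : Measure E} [μ.IsAddHaarMeasure]
  {V : Type*} [NormedAddCommGroup V] [NormedSpace ℝ V]

omit [FiniteDimensional ℝ E] [MeasurableSpace E] [BorelSpace E] in
theorem norm_fderiv_le_of_mem_closedBall {Φ : E → V} {R r : ℝ} (hr : r < R) {C : ℝ≥0}
    (hΦ : LipschitzOnWith C Φ (closedBall 0 R)) {y : E} (hy : y ∈ closedBall (0 : E) r) :
    ‖fderiv ℝ Φ y‖ ≤ C :=
  norm_fderiv_le_of_lipschitzOn ℝ
    (Filter.mem_of_superset (isOpen_ball.mem_nhds (closedBall_subset_ball hr hy))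
      ball_subset_closedBall) hΦ

theorem ae_differentiableAt_of_lipschitzOn_closedBall [FiniteDimensional ℝ V] {Φ : E → V}
    {R r : ℝ} (hr : r < R) {C : ℝ≥0} (hΦ : LipschitzOnWith C Φ (closedBall 0 R)) :
    ∀ᵐ y ∂μ.restrict (closedBall 0 r), DifferentiableAt ℝ Φ y := by
  rw [ae_restrict_iff' measurableSet_closedBall]
  filter_upwards [hΦ.ae_differentiableWithinAt_of_mem (μ := μ)] with y hy hyr
  have hyR := closedBall_subset_ball hr hyr
  exact (hy (ball_subset_closedBall hyR)).differentiableAt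
    (Filter.mem_of_superset (isOpen_ball.mem_nhds hyR) ball_subset_closedBall)

/-- If a Lipschitz map expands distances up to an additive error, then its derivative expands
vectors on average up to a multiplicative error. -/
theorem le_setIntegral_norm_fderiv [FiniteDimensional ℝ V] {Φ : E → V} {R r : ℝ}
    (hr0 : 0 < r) (hr : r < R) {C : ℝ≥0} (hΦ : LipschitzOnWith C Φ (closedBall 0 R)) {c : ℝ}
    (hc : 0 ≤ c)
    (hΦc : ∀ x ∈ closedBall (0 : E) R, ∀ y ∈ closedBall (0 : E) R, ‖x - y‖ - c ≤ ‖Φ x - Φ y‖)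
    (h : E) :
    (1 - c * Module.finrank ℝ E / (2 * r)) * ‖h‖ * μ.real (closedBall (0 : E) r) ≤
      ∫ y in closedBall (0 : E) r, ‖fderiv ℝ Φ y h‖ ∂μ := by
  rcases eq_or_ne h 0 with rfl | hh
  · simp
  have hfin : μ (closedBall (0 : E) r) ≠ ∞ := isBounded_closedBall.measure_lt_top.ne
  have hsmall : ∀ᶠ t : ℝ in nhdsWithin 0 (Ioi 0), 0 < t ∧ t * ‖h‖ ≤ R - r := by
    have h1 : Filter.Tendsto (fun t : ℝ => t * ‖h‖) (nhdsWithin 0 (Ioi 0)) (nhds 0) := by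
      have : Continuous fun t : ℝ => t * ‖h‖ := by fun_prop
      simpa using (this.tendsto 0).mono_left nhdsWithin_le_nhds
    filter_upwards [self_mem_nhdsWithin, h1.eventually (ge_mem_nhds (sub_pos.2 hr))] with t h1 h2
    exact ⟨h1, h2⟩
  have hmem : ∀ t : ℝ, 0 < t → t * ‖h‖ ≤ R - r → ∀ y ∈ closedBall (0 : E) r,
      y + t • h ∈ closedBall (0 : E) R := by
    intro t ht htR y hy
    rw [mem_closedBall_zero_iff] at hy ⊢
    have := norm_add_le y (t • h)
    rw [norm_smul, Real.norm_of_nonneg ht.le] at this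
    linarith
  have hsub : closedBall (0 : E) r ⊆ closedBall 0 R := closedBall_subset_closedBall hr.le
  have hcont : ∀ t : ℝ, 0 < t → t * ‖h‖ ≤ R - r →
      ContinuousOn (fun y => Φ (y + t • h) - Φ y) (closedBall (0 : E) r) := by
    intro t ht htR
    exact (hΦ.continuousOn.comp (by fun_prop) (hmem t ht htR)).sub (hΦ.continuousOn.mono hsub)
  have hlim : Filter.Tendsto
      (fun t : ℝ => ∫ y in closedBall (0 : E) r, ‖t⁻¹ • (Φ (y + t • h) - Φ y)‖ ∂μ)
      (nhdsWithin 0 (Ioi 0)) (nhds (∫ y in closedBall (0 : E) r, ‖fderiv ℝ Φ y h‖ ∂μ)) := by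
    -- Difference quotients are dominated through the Lipschitz bound and converge almost everywhere
    -- by Rademacher's theorem.
    refine tendsto_integral_filter_of_dominated_convergence (fun _ => C * ‖h‖) ?_ ?_ ?_ ?_
    · filter_upwards [hsmall] with t ht
      exact (((hcont t ht.1 ht.2).const_smul _).aestronglyMeasurable
        measurableSet_closedBall).norm
    · filter_upwards [hsmall] with t ht
      refine (ae_restrict_iff' measurableSet_closedBall).2 (ae_of_all _ fun y hy => ?_)
      have := hΦ.norm_sub_le (hmem t ht.1 ht.2 y hy) (hsub hy)
      rw [add_sub_cancel_left, norm_smul, Real.norm_of_nonneg ht.1.le] at this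
      rw [norm_norm, norm_smul, norm_inv, Real.norm_of_nonneg ht.1.le, inv_mul_le_iff₀ ht.1]
      linarith
    · exact integrableOn_const hfin
    · filter_upwards [ae_differentiableAt_of_lipschitzOn_closedBall (μ := μ) hr hΦ] with y hy
      exact (hy.hasFDerivAt.hasLineDerivAt h).tendsto_slope_zero_right.norm
  refine ge_of_tendsto hlim ?_
  filter_upwards [hsmall] with t ht
  have hth : t • h ≠ 0 := smul_ne_zero ht.1.ne' hh
  have hint : IntegrableOn (fun y => Φ (y + t • h) - Φ y) (closedBall (0 : E) r) μ :=
    (hcont t ht.1 ht.2).integrableOn_compact (isCompact_closedBall _ _)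
  have key := le_setIntegral_norm_translate_sub μ (convex_closedBall (0 : E) r)
    measurableSet_closedBall isBounded_closedBall hth (G := Φ) hint (c := c) (by
      intro z hz w hw
      have := hmem t ht.1 ht.2 _ hw
      rw [sub_add_cancel] at this
      exact hΦc w this z (hsub hz))
  -- The entry set has volume linear in `t`, so the error stays bounded after division by `t`.
  have hA := measureReal_entrySet_closedBall_le μ hr0 (t • h)
  simp only [norm_smul, norm_inv, Real.norm_of_nonneg ht.1.le] at hA key ⊢
  rw [integral_const_mul, le_inv_mul_iff₀ ht.1]
  refine le_trans ?_ key
  calc _ = t * ‖h‖ * μ.real (closedBall (0 : E) r) - c * (μ.real (closedBall (0 : E) r) *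
        (Module.finrank ℝ E * (t * ‖h‖) / (2 * r))) := by ring
    _ ≤ _ := by gcongr

end AverageDerivative

/-! ### Linear fields and embeddings of `L_p` spaces -/

section LpEmbedding

variable {p : ℝ≥0∞}

/-- Every `L_p` space of a standard Borel probability space embeds isometrically into
`L_p([0, 1])`. -/
theorem exists_linearIsometry_LpUnitInterval [Fact (1 ≤ p)] {Ω : Type*} [MeasurableSpace Ω]
    [StandardBorelSpace Ω] (ν : Measure Ω) [IsProbabilityMeasure ν] :
    Nonempty (Lp ℝ p ν →ₗᵢ[ℝ] LpUnitInterval p) := by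
  have : Nonempty Ω := nonempty_of_isProbabilityMeasure ν
  obtain ⟨f, hf, hfν⟩ := ν.exists_measurable_map_eq
  have hproj : Measurable (projIcc (0 : ℝ) 1 zero_le_one) := continuous_projIcc.measurable
  have hmap : (volume.restrict (Icc (0 : ℝ) 1)).map (projIcc (0 : ℝ) 1 zero_le_one) =
      (volume : Measure unitInterval) := by
    rw [← map_comap_subtype_coe measurableSet_Icc, Measure.map_map hproj measurable_subtype_coe]
    have : projIcc (0 : ℝ) 1 zero_le_one ∘ ((↑) : Icc (0 : ℝ) 1 → ℝ) = id :=
      funext fun x => projIcc_val _ x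
    rw [this, Measure.map_id]
    rfl
  have hmp : MeasurePreserving (f ∘ projIcc (0 : ℝ) 1 zero_le_one)
      (volume.restrict (Icc (0 : ℝ) 1)) ν :=
    ⟨hf.comp hproj, by rw [← Measure.map_map hf hproj, hmap, hfν]⟩
  exact ⟨Lp.compMeasurePreservingₗᵢ ℝ _ hmp⟩

theorem eLpNorm_prod_eq_of_forall_fiber (hp0 : p ≠ 0) (hp : p ≠ ∞) {Ω S V : Type*}
    [MeasurableSpace Ω] [MeasurableSpace S] {ν : Measure Ω} {μ : Measure S} [SFinite μ]
    [NormedAddCommGroup V] {f : Ω × S → ℝ} (hf : Measurable f) {g : Ω → V}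
    (hfg : ∀ y, eLpNorm (fun t => f (y, t)) p μ = ‖g y‖ₑ) :
    eLpNorm f p (ν.prod μ) = eLpNorm g p ν := by
  have hp' : 0 < p.toReal := ENNReal.toReal_pos hp0 hp
  rw [eLpNorm_eq_lintegral_rpow_enorm_toReal hp0 hp, eLpNorm_eq_lintegral_rpow_enorm_toReal hp0 hp,
    lintegral_prod _ (hf.enorm.pow_const _).aemeasurable]
  congr 1
  refine lintegral_congr fun y => ?_
  rw [← hfg, eLpNorm_eq_lintegral_rpow_enorm_toReal hp0 hp, ← ENNReal.rpow_mul,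
    one_div_mul_cancel hp'.ne', ENNReal.rpow_one]

variable {S : Type*} [MeasurableSpace S] {μ : Measure S}

/-- A field of linear maps into a finite dimensional space of functions in `L_p(μ)` that is bounded
almost everywhere and bounded below on average gives a map into `L_p(ν × μ)`. -/
theorem exists_Lp_prod_of_field [Fact (1 ≤ p)] (hp : p ≠ ∞) [SFinite μ] {E : Type*}
    [NormedAddCommGroup E] [NormedSpace ℝ E] [MeasurableSpace E] {V : Type*}
    [NormedAddCommGroup V] [NormedSpace ℝ V] [FiniteDimensional ℝ V] [MeasurableSpace V]
    [BorelSpace V] {rep : V → S → ℝ} (hrep : Measurable rep.uncurry)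
    (hrep_sub : ∀ v w t, rep (v - w) t = rep v t - rep w t)
    (hrep_norm : ∀ v, eLpNorm (rep v) p μ = ‖v‖ₑ) (ν : Measure E) [IsProbabilityMeasure ν] {L : E → E →L[ℝ] V}
    (hL : ∀ x, Measurable fun y => L y x) {C m : ℝ} (hC : 0 ≤ C)
    (hLC : ∀ᵐ y ∂ν, ‖L y‖ ≤ C) (hLm : ∀ x, m * ‖x‖ ≤ ∫ y, ‖L y x‖ ∂ν) :
    ∃ T : E → Lp ℝ p (ν.prod μ),
      ∀ x y, m * ‖x - y‖ ≤ ‖T x - T y‖ ∧ ‖T x - T y‖ ≤ C * ‖x - y‖ := by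
  have hp1 : 1 ≤ p := Fact.out
  have hp0 : p ≠ 0 := (zero_lt_one.trans_le hp1).ne'
  set f : E → E × S → ℝ := fun x z => rep (L z.1 x) z.2 with hf
  have hfm : ∀ x, Measurable (f x) := fun x => 
    hrep.comp (((hL x).comp measurable_fst).prodMk measurable_snd)
  have hsm : ∀ x, AEStronglyMeasurable (fun y => L y x) ν := fun x =>
    (hL x).aestronglyMeasurable
  have hnorm : ∀ x, eLpNorm (f x) p (ν.prod μ) = eLpNorm (fun y => L y x) p ν := by
    intro x
    exact eLpNorm_prod_eq_of_forall_fiber (g := fun y => L y x) hp0 hp (hfm x)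
      fun y => hrep_norm (L y x)
  have hbound : ∀ x, ∀ᵐ y ∂ν, ‖L y x‖ ≤ C * ‖x‖ := fun x => hLC.mono fun y hy =>
    ((L y).le_opNorm x).trans (mul_le_mul_of_nonneg_right hy (norm_nonneg x))
  have hle : ∀ x, eLpNorm (fun y => L y x) p ν ≤ ENNReal.ofReal (C * ‖x‖) := by
    intro x
    simpa using eLpNorm_le_of_ae_bound (p := p) (hbound x)
  have hge : ∀ x, ENNReal.ofReal (m * ‖x‖) ≤ eLpNorm (fun y => L y x) p ν := by
    intro x
    -- On a probability space the `L_p` norm dominates the mean, the only lower information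
    -- available.
    refine le_trans ?_ (eLpNorm_le_eLpNorm_of_exponent_le hp1 (hsm x))
    rw [eLpNorm_one_eq_lintegral_enorm, ← ofReal_integral_norm_eq_lintegral_enorm]
    · exact ENNReal.ofReal_le_ofReal (hLm x)
    · exact Integrable.of_bound (hsm x) _ (hbound x)
  have hmem : ∀ x, MemLp (f x) p (ν.prod μ) := fun x =>
    ⟨(hfm x).aestronglyMeasurable, by
      rw [hnorm]; exact (hle x).trans_lt ENNReal.ofReal_lt_top⟩
  refine ⟨fun x => (hmem x).toLp, fun x y => ?_⟩
  have hsub : f x - f y = f (x - y) := by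
    ext z
    simp [hf, hrep_sub]
  have key : ‖(hmem x).toLp - (hmem y).toLp‖ = (eLpNorm (fun z => L z (x - y)) p ν).toReal := by
    rw [← MemLp.toLp_sub, Lp.norm_toLp, hsub, hnorm]
  rw [key]
  have htop := ((hle (x - y)).trans_lt ENNReal.ofReal_lt_top).ne
  exact ⟨(ENNReal.ofReal_le_iff_le_toReal htop).1 (hge _),
    ENNReal.toReal_le_of_le_ofReal (by positivity) (hle _)⟩

/-- Representatives of the elements of a finite dimensional subspace of `L_p` which depend
linearly on the element. -/
noncomputable def linearRep (V : Submodule ℝ (Lp ℝ p μ)) [FiniteDimensional ℝ V] (v : V) (t : S) :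
    ℝ :=
  ∑ i, (Module.finBasis ℝ V).repr v i * (Module.finBasis ℝ V i : Lp ℝ p μ) t

variable {V : Submodule ℝ (Lp ℝ p μ)} [FiniteDimensional ℝ V]

theorem linearRep_sub (v w : V) (t : S) :
    linearRep V (v - w) t = linearRep V v t - linearRep V w t := by
  simp [linearRep, sub_mul]

theorem linearRep_ae_eq (v : V) : linearRep V v =ᵐ[μ] (v : Lp ℝ p μ) := by
  have h1 : (v : Lp ℝ p μ) =
      ∑ i, (Module.finBasis ℝ V).repr v i • (Module.finBasis ℝ V i : Lp ℝ p μ) :=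
    (congrArg V.subtype ((Module.finBasis ℝ V).sum_repr v)).symm.trans
      (by simp only [map_sum, map_smul, Submodule.subtype_apply])
  have h2 : ∀ i, ⇑((Module.finBasis ℝ V).repr v i • (Module.finBasis ℝ V i : Lp ℝ p μ)) =ᵐ[μ]
      (Module.finBasis ℝ V).repr v i • ⇑(Module.finBasis ℝ V i : Lp ℝ p μ) :=
    fun i => Lp.coeFn_smul _ _
  have h3 := Lp.coeFn_fun_finsetSum Finset.univ
    (fun i => (Module.finBasis ℝ V).repr v i • (Module.finBasis ℝ V i : Lp ℝ p μ))
  rw [← h1] at h3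
  filter_upwards [h3, ae_all_iff.2 h2] with t ht ht2
  rw [ht, linearRep]
  refine Finset.sum_congr rfl fun i _ => ?_
  rw [ht2 i]
  rfl

theorem eLpNorm_linearRep [Fact (1 ≤ p)] (v : V) : eLpNorm (linearRep V v) p μ = ‖v‖ₑ := by
  rw [eLpNorm_congr_ae (linearRep_ae_eq v), ← Lp.enorm_def]
  rfl

/-- Fixing representatives of a basis gives joint measurability, which arbitrary representatives of
each vector would not. -/
theorem measurable_linearRep [Fact (1 ≤ p)] [MeasurableSpace V] [BorelSpace V] :
    Measurable (linearRep V).uncurry := by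
  change Measurable fun z : V × S =>
    ∑ i, (Module.finBasis ℝ V).repr z.1 i * (Module.finBasis ℝ V i : Lp ℝ p μ) z.2
  refine Finset.measurable_sum _ fun i _ => Measurable.mul ?_ ?_
  · have : Continuous fun v : V => (Module.finBasis ℝ V).repr v i :=
      ((Module.finBasis ℝ V).coord i).continuous_of_finiteDimensional
    exact this.measurable.comp measurable_fst
  · exact (Lp.stronglyMeasurable _).measurable.comp measurable_snd

end LpEmbedding

/-! ### Euclidean space inside `L_p` -/

section EuclideanEmbedding

variable {p : ℝ≥0∞}

/-- Euclidean space embeds into `L_p([0, 1])` with distortion `1`. -/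
theorem exists_euclideanSpace_embedding [Fact (1 ≤ p)] {n : ℕ} (hn : 1 ≤ n) :
    ∃ (T : EuclideanSpace ℝ (Fin n) → LpUnitInterval p) (a : ℝ), 0 < a ∧
      ∀ x y, ‖T x - T y‖ = a * ‖x - y‖ := by
  have hp1 : 1 ≤ p := Fact.out
  have hp0 : p ≠ 0 := (zero_lt_one.trans_le hp1).ne'
  set W := EuclideanSpace ℝ (Fin n)
  set ν : Measure W := ProbabilityTheory.cond volume (closedBall (0 : W) 1) with hν
  have hfin : volume (closedBall (0 : W) 1) ≠ ∞ := isBounded_closedBall.measure_lt_top.ne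
  have hpos : volume (closedBall (0 : W) 1) ≠ 0 := (measure_closedBall_pos _ _ one_pos).ne'
  have : IsProbabilityMeasure ν := ProbabilityTheory.cond_isProbabilityMeasure_of_finite hpos hfin
  set f : W → W → ℝ := fun x w => inner ℝ x w with hf
  have hfc : ∀ x, Continuous (f x) := fun x => by fun_prop
  have hmem : ∀ x, MemLp (f x) p ν := by
    intro x
    refine MemLp.of_bound (hfc x).aestronglyMeasurable ‖x‖ ?_
    rw [hν, ProbabilityTheory.cond]
    refine Measure.ae_smul_measure ?_ _
    refine (ae_restrict_iff' measurableSet_closedBall).2 (ae_of_all _ fun w hw => ?_)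
    have hw' : ‖w‖ ≤ 1 := by simpa using hw
    exact (norm_inner_le_norm x w).trans (mul_le_of_le_one_right (norm_nonneg _) hw')
  have hrot : ∀ O : W ≃ₗᵢ[ℝ] W, MeasurePreserving O ν ν := by
    intro O
    have h1 := O.measurePreserving.restrict_preimage
      (measurableSet_closedBall (x := (0 : W)) (ε := 1))
    have h2 : O ⁻¹' closedBall (0 : W) 1 = closedBall 0 1 := by
      rw [LinearIsometryEquiv.preimage_closedBall, map_zero]
    rw [h2] at h1
    exact h1.smul_measure _
  have hinv : ∀ (O : W ≃ₗᵢ[ℝ] W) x, eLpNorm (f (O x)) p ν = eLpNorm (f x) p ν := by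
    intro O x
    rw [← eLpNorm_comp_measurePreserving (hfc (O x)).aestronglyMeasurable (hrot O)]
    congr 1
    ext w
    exact O.inner_map_map x w
  set e : W := EuclideanSpace.single ⟨0, hn⟩ 1 with he
  have hnorm : ‖e‖ = 1 := (PiLp.norm_single 2 (fun _ => ℝ) _ _).trans (by simp)
  have hval : ∀ x, eLpNorm (f x) p ν = ‖x‖ₑ * eLpNorm (f e) p ν := by
    intro x
    have hx : ‖‖x‖ • e‖ = ‖x‖ := by rw [norm_smul, hnorm]; simp
    -- This reflection carries `‖x‖ • e` to `x`, so by invariance the `L_p` norm of `⟨x, ·⟩` depends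
    -- only on `‖x‖`.
    have h1 := hinv (ℝ ∙ (‖x‖ • e - x))ᗮ.reflection (‖x‖ • e)
    rw [Submodule.reflection_sub hx] at h1
    rw [h1, ← enorm_norm x, ← eLpNorm_const_smul]
    congr 1
    ext w
    simp [hf, inner_smul_left]
  have hne : eLpNorm (f e) p ν ≠ 0 := by
    intro h0
    rw [eLpNorm_eq_zero_iff (hfc e).aestronglyMeasurable hp0, hν, ProbabilityTheory.cond,
      Filter.EventuallyEq, Measure.ae_ennreal_smul_measure_iff (ENNReal.inv_ne_zero.2 hfin),
      ae_restrict_iff' measurableSet_closedBall] at h0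
    have h1 := Measure.addHaar_submodule (volume : Measure W) (innerSL ℝ e).ker (by
      intro h
      have : e ∈ (innerSL ℝ e).ker := h ▸ Submodule.mem_top
      have h2 : inner ℝ e e = (0 : ℝ) := by simpa using this
      rw [real_inner_self_eq_norm_sq, hnorm] at h2
      norm_num at h2)
    refine hpos (measure_mono_null_ae ?_ h1)
    filter_upwards [h0] with w hw hwb
    exact hw hwb
  obtain ⟨U⟩ := exists_linearIsometry_LpUnitInterval (p := p) ν
  refine ⟨fun x => U ((hmem x).toLp), (eLpNorm (f e) p ν).toReal,
    ENNReal.toReal_pos hne (hmem e).2.ne, fun x y => ?_⟩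
  have hsub : f x - f y = f (x - y) := by
    ext z
    simp [hf, inner_sub_left]
  rw [← map_sub, U.norm_map, ← MemLp.toLp_sub, Lp.norm_toLp, hsub, hval, ENNReal.toReal_mul,
    toReal_enorm, mul_comm]

end EuclideanEmbedding

/-! ### John's theorem by maximizing a determinant -/

section John

/-- An operator of norm at most one stays so after stretching Euclidean space suitably in a
direction in which the operator is small. -/
theorem norm_map_stretch_le {W E : Type*} [NormedAddCommGroup W] [InnerProductSpace ℝ W]
    [CompleteSpace W] [NormedAddCommGroup E] [NormedSpace ℝ E] {T : W →L[ℝ] E} (hT : ‖T‖ ≤ 1)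
    {v : W} (hv : ‖v‖ = 1) {a b : ℝ} (hab : b ^ 2 ≤ a ^ 2)
    (h : b ^ 2 + (a ^ 2 - b ^ 2) * ‖T v‖ ^ 2 ≤ 1) (w : W) :
    ‖T (b • w + ((a - b) * inner ℝ v w) • v)‖ ≤ ‖w‖ := by
  obtain ⟨φ, hφ1, hφ⟩ := exists_dual_vector'' ℝ (T (b • w + ((a - b) * inner ℝ v w) • v))
  set ξ : W := (InnerProductSpace.toDual ℝ W).symm (φ ∘L T)
  have hξ : ∀ w, inner ℝ ξ w = φ (T w) := fun w => by
    simp [ξ, InnerProductSpace.toDual_symm_apply]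
  have hξ1 : ‖ξ‖ ≤ 1 := by
    rw [LinearIsometryEquiv.norm_map]
    exact (ContinuousLinearMap.opNorm_comp_le _ _).trans (mul_le_one₀ hφ1 (norm_nonneg _) hT)
  set q : ℝ := inner ℝ ξ v with hq
  have hqρ : |q| ≤ ‖T v‖ := by
    rw [hq, hξ]
    exact (φ.le_of_opNorm_le hφ1 _).trans (by rw [one_mul])
  have hq2 : q ^ 2 ≤ ‖T v‖ ^ 2 := sq_le_sq.2 (by rwa [abs_norm])
  -- The stretch is self-adjoint; moved onto the vector `ξ` representing `φ ∘ T`, it gives `η`.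
  set η : W := b • ξ + ((a - b) * q) • v with hη_def
  have hη : ‖η‖ ≤ 1 := by
    have h1 : ‖η‖ ^ 2 = b ^ 2 * ‖ξ‖ ^ 2 + (a ^ 2 - b ^ 2) * q ^ 2 := by
      rw [hη_def, norm_add_sq_real, norm_smul, norm_smul, inner_smul_left, inner_smul_right, hv,
        mul_pow, mul_pow, ← hq]
      simp only [Real.norm_eq_abs, sq_abs, conj_trivial]
      ring
    have h2 : ‖ξ‖ ^ 2 ≤ 1 := by
      rw [sq_le_one_iff₀ (norm_nonneg _)]; exact hξ1
    have h3 : ‖η‖ ^ 2 ≤ 1 := by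
      rw [h1]
      have h4 : b ^ 2 * ‖ξ‖ ^ 2 ≤ b ^ 2 := mul_le_of_le_one_right (sq_nonneg b) h2
      have h5 := mul_le_mul_of_nonneg_left hq2 (sub_nonneg.2 hab)
      linarith
    rwa [sq_le_one_iff₀ (norm_nonneg _)] at h3
  have h1 : φ (T (b • w + ((a - b) * inner ℝ v w) • v)) = inner ℝ η w := by
    rw [← hξ, hη_def, inner_add_right, inner_add_left, inner_smul_right, inner_smul_right,
      inner_smul_left, inner_smul_left, ← hq]
    simp only [conj_trivial]
    ring
  have h2 : ‖T (b • w + ((a - b) * inner ℝ v w) • v)‖ = inner ℝ η w := by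
    rw [← h1, hφ]; rfl
  rw [h2]
  exact (real_inner_le_norm η w).trans (mul_le_of_le_one_left (norm_nonneg _) hη)

/-- Maximality of the determinant forces an operator of norm at most one from Euclidean space to
be bounded below by `1 / √n`. -/
theorem norm_le_sqrt_mul_of_isMaxOn_det {n : ℕ} (hn : 1 ≤ n) {W E : Type*}
    [NormedAddCommGroup W] [InnerProductSpace ℝ W] [FiniteDimensional ℝ W]
    (hW : Module.finrank ℝ W = n) [NormedAddCommGroup E] [NormedSpace ℝ E] (e : E →L[ℝ] W)
    {T : W →L[ℝ] E} (hT : ‖T‖ ≤ 1) (hdet : (e ∘L T).det ≠ 0)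
    (hmax : ∀ T' : W →L[ℝ] E, ‖T'‖ ≤ 1 → |(e ∘L T').det| ≤ |(e ∘L T).det|)
    (x : W) : ‖x‖ ≤ √n * ‖T x‖ := by
  by_contra! hx
  have hx0 : 0 < ‖x‖ := (by positivity : 0 ≤ √(n : ℝ) * ‖T x‖).trans_lt hx
  set v : W := ‖x‖⁻¹ • x with hv
  have hv1 : ‖v‖ = 1 := by rw [hv, norm_smul, norm_inv, norm_norm, inv_mul_cancel₀ hx0.ne']
  set ρ := ‖T v‖ with hρ
  have hn' : (1 : ℝ) ≤ n := by exact_mod_cast hn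
  have hρ0 : 0 ≤ ρ := norm_nonneg _
  have hρn : n * ρ ^ 2 < 1 := by
    have h1 : √n * ρ < 1 := by
      rw [hρ, hv, map_smul, norm_smul, norm_inv, norm_norm, mul_left_comm, inv_mul_lt_iff₀ hx0]
      simpa using hx
    have h2 : (√n * ρ) ^ 2 < 1 := by
      rw [sq_lt_one_iff₀ (by positivity)]; exact h1
    rwa [mul_pow, Real.sq_sqrt (by positivity)] at h2
  -- Stretch by `a` along `v` and by `b` across it, where `a² - b² = s` and `b² + (a² - b²)ρ² = 1`,
  -- so the norm stays at most one. The squared determinant gains `s(1 - nρ²) = s²` to first order,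
  -- which dictates this `s`.
  set s := 1 - n * ρ ^ 2 with hs
  have hs0 : 0 < s := by linarith
  have hρ1 : ρ ^ 2 < 1 := by nlinarith [sq_nonneg ρ]
  have hs1 : s ≤ 1 := by nlinarith [sq_nonneg ρ]
  have hb2 : 0 < 1 - ρ ^ 2 * s := by nlinarith [sq_nonneg ρ]
  set a := √(1 + (1 - ρ ^ 2) * s)
  set b := √(1 - ρ ^ 2 * s)
  have ha2 : a ^ 2 = 1 + (1 - ρ ^ 2) * s := Real.sq_sqrt (by nlinarith)
  have hbsq : b ^ 2 = 1 - ρ ^ 2 * s := Real.sq_sqrt hb2.le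
  have hb0 : 0 < b := Real.sqrt_pos.2 hb2
  have ha0 : 0 ≤ a := Real.sqrt_nonneg _
  set A : W →L[ℝ] W := b • (ContinuousLinearMap.id ℝ W + ((a - b) / b) • (innerSL ℝ v).smulRight v)
    with hA
  have hAw : ∀ w, A w = b • w + ((a - b) * inner ℝ v w) • v := by
    intro w
    simp only [hA, smul_apply, add_apply,
      ContinuousLinearMap.id_apply, ContinuousLinearMap.smulRight_apply, innerSL_apply_apply,
      smul_add, smul_smul]
    congr 2
    field_simp
  have hdetA : A.det = a * b ^ (n - 1) := by
    have h1 : (A : W →ₗ[ℝ] W) =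
        b • LinearMap.transvection (((a - b) / b) • (innerSL ℝ v : W →ₗ[ℝ] ℝ)) v := by
      ext1 w
      simp [hA, LinearMap.transvection, smul_smul, mul_assoc]
    rw [ContinuousLinearMap.det, h1, LinearMap.det_smul, LinearMap.transvection.det, hW]
    simp only [LinearMap.smul_apply, ContinuousLinearMap.coe_coe, innerSL_apply_apply,
      real_inner_self_eq_norm_sq, hv1, smul_eq_mul]
    obtain ⟨k, rfl⟩ : ∃ k, n = k + 1 := ⟨n - 1, by omega⟩
    simp only [Nat.add_sub_cancel]
    field_simp
    ring
  have hdet1 : 1 < |A.det| := by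
    rw [hdetA, abs_of_nonneg (by positivity)]
    have hB := one_add_mul_le_pow (a := -(ρ ^ 2 * s)) (by nlinarith) (n - 1)
    have hcast : ((n - 1 : ℕ) : ℝ) = n - 1 := by push_cast [Nat.cast_sub hn]; ring
    rw [hcast, ← sub_eq_add_neg, ← hbsq] at hB
    have h3 : 1 < (a * b ^ (n - 1)) ^ 2 := by
      have h4 : (a * b ^ (n - 1)) ^ 2 = (1 + (1 - ρ ^ 2) * s) * (b ^ 2) ^ (n - 1) := by
        rw [mul_pow, ha2, ← pow_mul, ← pow_mul, mul_comm 2]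
      rw [h4]
      have h5 : 0 < 1 + (1 - ρ ^ 2) * s := by nlinarith
      refine lt_of_lt_of_le ?_ (mul_le_mul_of_nonneg_left hB h5.le)
      have hX : (1 - ρ ^ 2) * ((n - 1) * ρ ^ 2) < 1 := by
        nlinarith [sq_nonneg ρ, mul_nonneg (sub_nonneg.2 hn') (sq_nonneg ρ)]
      have h6 : (1 + (1 - ρ ^ 2) * s) * (1 + (n - 1) * -(ρ ^ 2 * s)) =
          1 + s ^ 2 * (1 - (1 - ρ ^ 2) * ((n - 1) * ρ ^ 2)) := by
        rw [hs]; ring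
      rw [h6]
      have : 0 < s ^ 2 * (1 - (1 - ρ ^ 2) * ((n - 1) * ρ ^ 2)) :=
        mul_pos (by positivity) (by linarith)
      linarith
    exact (one_lt_sq_iff₀ (by positivity)).1 h3
  have hTA : ‖T ∘L A‖ ≤ 1 := by
    refine ContinuousLinearMap.opNorm_le_bound _ zero_le_one fun w => ?_
    rw [one_mul, ContinuousLinearMap.comp_apply, hAw]
    refine norm_map_stretch_le hT hv1 (by nlinarith) ?_ w
    rw [ha2, hbsq, ← hρ]
    nlinarith
  have h1 := hmax _ hTA
  have h2 : (e ∘L (T ∘L A)).det = (e ∘L T).det * A.det := by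
    simp only [ContinuousLinearMap.det]
    rw [← LinearMap.det_comp]
    rfl
  rw [h2, abs_mul] at h1
  have h3 : 0 < |(e ∘L T).det| := abs_pos.2 hdet
  nlinarith

/-- John's theorem: every `n`-dimensional normed space is `√n`-isomorphic to Euclidean space. -/
theorem exists_euclideanSpace_norm_le {n : ℕ} (hn : 1 ≤ n) {E : Type*} [NormedAddCommGroup E]
    [NormedSpace ℝ E] [FiniteDimensional ℝ E] (hE : Module.finrank ℝ E = n) :
    ∃ S : E →ₗ[ℝ] EuclideanSpace ℝ (Fin n), ∀ x, ‖x‖ ≤ ‖S x‖ ∧ ‖S x‖ ≤ √n * ‖x‖ := by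
  set W := EuclideanSpace ℝ (Fin n)
  have hfr : Module.finrank ℝ E = Module.finrank ℝ W := by simp [W, hE]
  set e : E ≃L[ℝ] W := ContinuousLinearEquiv.ofFinrankEq hfr
  have hc : Continuous fun T : W →L[ℝ] E => |((e : E →L[ℝ] W) ∘L T).det| :=
    (ContinuousLinearMap.continuous_det.comp
      (continuous_const.clm_comp continuous_id)).abs
  obtain ⟨T, hT, hmax⟩ := (isCompact_closedBall (0 : W →L[ℝ] E) 1).exists_isMaxOn
    ⟨0, by simp⟩ hc.continuousOn
  have hT1 : ‖T‖ ≤ 1 := by simpa using hT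
  have hmax' : ∀ T' : W →L[ℝ] E, ‖T'‖ ≤ 1 →
      |((e : E →L[ℝ] W) ∘L T').det| ≤ |((e : E →L[ℝ] W) ∘L T).det| := fun T' hT' =>
    hmax (by simpa using hT')
  -- A rescaled inverse of `e` is a competitor with nonzero determinant.
  have hdet : ((e : E →L[ℝ] W) ∘L T).det ≠ 0 := by
    set i : W →L[ℝ] E := (e.symm : W →L[ℝ] E)
    have hpos : 0 < 1 + ‖i‖ := by positivity
    have h1 := hmax' ((1 + ‖i‖)⁻¹ • i) (by
      rw [norm_smul, norm_inv, Real.norm_of_nonneg hpos.le, inv_mul_le_iff₀ hpos]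
      linarith)
    have h2 : (e : E →L[ℝ] W) ∘L ((1 + ‖i‖)⁻¹ • i) = (1 + ‖i‖)⁻¹ • ContinuousLinearMap.id ℝ W := by
      ext1 w
      simp [i]
    have h3 : ((1 + ‖i‖)⁻¹ • ContinuousLinearMap.id ℝ W).det ≠ 0 := by
      rw [ContinuousLinearMap.det, ContinuousLinearMap.toLinearMap_smul, LinearMap.det_smul]
      simp [hpos.ne']
    rw [h2] at h1
    exact abs_pos.1 ((abs_pos.2 h3).trans_le h1)
  have hlow := norm_le_sqrt_mul_of_isMaxOn_det hn (by simp [W]) (e : E →L[ℝ] W) hT1 hdet hmax'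
  have hinj : Function.Injective T := by
    refine (injective_iff_map_eq_zero T).2 fun x hx => ?_
    have := hlow x
    rw [hx, norm_zero, mul_zero] at this
    exact norm_le_zero_iff.1 this
  set Te : W ≃ₗ[ℝ] E := LinearEquiv.ofInjectiveOfFinrankEq (T : W →ₗ[ℝ] E) hinj hfr.symm
  have hTe : ∀ x, T (Te.symm x) = x := fun x => Te.apply_symm_apply x
  refine ⟨Te.symm, fun x => ⟨?_, ?_⟩⟩
  · have := T.le_of_opNorm_le hT1 (Te.symm x)
    rwa [hTe, one_mul] at this
  · have := hlow (Te.symm x)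
    rwa [hTe] at this

end John

/-! ### A priori bounds on distortion -/

section Distortion

theorem distortion_le_ofReal_div {X Y : Type*} [NormedAddCommGroup X] [NormedAddCommGroup Y]
    {T : X → Y} {m M : ℝ} (hm : 0 < m) (hmM : m ≤ M)
    (hT : ∀ x y, m * ‖x - y‖ ≤ ‖T x - T y‖ ∧ ‖T x - T y‖ ≤ M * ‖x - y‖) :
    distortion X Y ≤ ENNReal.ofReal (M / m) := by
  refine sInf_le ⟨?_, T, m.toNNReal, Real.toNNReal_pos.2 hm, fun x y => ?_⟩
  · rw [ENNReal.one_le_ofReal, one_le_div hm]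
    exact hmM
  · rw [edist_dist, edist_dist, dist_eq_norm, dist_eq_norm, ← ENNReal.ofReal,
      ← ENNReal.ofReal_mul hm.le, ← ENNReal.ofReal_mul (div_nonneg (hm.le.trans hmM) hm.le),
      ← ENNReal.ofReal_mul (mul_nonneg (div_nonneg (hm.le.trans hmM) hm.le) hm.le), div_mul_cancel₀ _ hm.ne']
    exact ⟨ENNReal.ofReal_le_ofReal (hT x y).1, ENNReal.ofReal_le_ofReal (hT x y).2⟩

theorem distortion_LpUnitInterval_le_sqrt (p : ℝ≥0∞) [Fact (1 ≤ p)] {n : ℕ} (hn : 1 ≤ n)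
    {X : Type*} [NormedAddCommGroup X] [NormedSpace ℝ X] [FiniteDimensional ℝ X]
    (hX : Module.finrank ℝ X = n) : distortion X (LpUnitInterval p) ≤ ENNReal.ofReal √n := by
  obtain ⟨S, hS⟩ := exists_euclideanSpace_norm_le hn hX
  obtain ⟨T, a, ha, hT⟩ := exists_euclideanSpace_embedding (p := p) hn
  have h1 : 1 ≤ √(n : ℝ) := Real.one_le_sqrt.2 (by exact_mod_cast hn)
  have := distortion_le_ofReal_div (T := fun x => T (S x)) (m := a) (M := a * √n) ha
    (le_mul_of_one_le_right ha.le h1) (fun x y => by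
      rw [hT, ← map_sub, mul_assoc]
      exact ⟨mul_le_mul_of_nonneg_left (hS _).1 ha.le, mul_le_mul_of_nonneg_left (hS _).2 ha.le⟩)
  rwa [mul_div_cancel_left₀ _ ha.ne'] at this

end Distortion

/-! ### From a net to the whole space -/

section Extension

variable {X : Type*} [NormedAddCommGroup X]

theorem exists_simpleFunc_dist_le [MeasurableSpace X] [OpensMeasurableSpace X] {t : Set X}
    (ht : t.Finite) (ht0 : t.Nonempty) {η : ℝ} {s : Set X}
    (hη : ∀ x ∈ s, ∃ y ∈ t, dist x y ≤ η) :
    ∃ π : SimpleFunc X X, (∀ x, π x ∈ t) ∧ ∀ x ∈ s, dist (π x) x ≤ η := by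
  obtain ⟨e, he⟩ := ht.countable.exists_eq_range ht0
  have hk : ∀ y : X, ∃ k, y ∈ t → e k = y := fun y => by
    by_cases hy : y ∈ t
    · obtain ⟨k, hk⟩ := he ▸ hy
      exact ⟨k, fun _ => hk⟩
    · exact ⟨0, fun h => absurd h hy⟩
  choose k hk using hk
  -- The cutoff is large enough for the enumeration to have met every point of `t`.
  refine ⟨SimpleFunc.nearestPt e (ht.toFinset.sup k), fun x => ?_, fun x hx => ?_⟩
  · exact he.symm.subset (mem_range_self _)
  · obtain ⟨y, hy, hxy⟩ := hη x hx
    have h1 := SimpleFunc.edist_nearestPt_le e x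
      (Finset.le_sup (f := k) (ht.mem_toFinset.2 hy))
    rw [hk y hy, edist_dist, edist_dist, ENNReal.ofReal_le_ofReal_iff dist_nonneg] at h1
    rw [dist_comm] at hxy
    exact h1.trans hxy

/-- Finiteness makes the rounding map simple and the span of the image finite dimensional, as
Rademacher's theorem requires; the price is doubling `δ`. -/
theorem IsNetInUnitBall.exists_finite_subset [NormedSpace ℝ X] [FiniteDimensional ℝ X] {δ : ℝ}
    (hδ : 0 < δ) {N : Set X} (hN : IsNetInUnitBall δ.toNNReal N) :
    ∃ t ⊆ N, t.Finite ∧ t.Nonempty ∧ ∀ x ∈ closedBall (0 : X) 1, ∃ y ∈ t, dist x y ≤ 2 * δ := by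
  have htb : TotallyBounded N := (isCompact_closedBall (0 : X) 1).totallyBounded.subset hN.1
  obtain ⟨t, htN, htf, htc⟩ := exists_finite_isCover_of_totallyBounded
    (Real.toNNReal_pos.2 hδ).ne' htb
  have hdist : ∀ x y : X, edist x y ≤ δ.toNNReal → dist x y ≤ δ := by
    intro x y h
    rw [edist_dist, ← ENNReal.ofReal, ENNReal.ofReal_le_ofReal_iff hδ.le] at h
    exact h
  have hcov : ∀ x ∈ closedBall (0 : X) 1, ∃ y ∈ t, dist x y ≤ 2 * δ := by
    intro x hx
    obtain ⟨z, hz, hxz⟩ := hN.2 hx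
    obtain ⟨y, hy, hzy⟩ := htc hz
    exact ⟨y, hy, by linarith [dist_triangle x z y, hdist _ _ hxz, hdist _ _ hzy]⟩
  obtain ⟨y, hy, -⟩ := hcov 0 (by simp)
  exact ⟨t, htN, htf, ⟨y, hy⟩, hcov⟩

variable [NormedSpace ℝ X] [FiniteDimensional ℝ X]

/-- A bi-Lipschitz map on a net of the unit ball with values in a finite dimensional space gives
rise to a field of linear maps which are bounded and, on average, bounded below. -/
theorem exists_linear_field [MeasurableSpace X] [BorelSpace X] {V : Type*} [NormedAddCommGroup V]
    [NormedSpace ℝ V] [FiniteDimensional ℝ V] [MeasurableSpace V] [BorelSpace V] {t : Set X}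
    (ht : t.Finite) (ht0 : t.Nonempty) {η D τ : ℝ} (hη : 0 ≤ η) (hD : 0 ≤ D) (hτ : 0 < τ)
    (hτ' : τ < 1 / 2) (htη : ∀ x ∈ closedBall (0 : X) 1, ∃ y ∈ t, dist x y ≤ η) {g : X → V}
    (hg : ∀ x ∈ t, ∀ y ∈ t, ‖x - y‖ ≤ ‖g x - g y‖ ∧ ‖g x - g y‖ ≤ D * ‖x - y‖) :
    ∃ (ν : Measure X) (_ : IsProbabilityMeasure ν) (L : X → X →L[ℝ] V),
      (∀ x, Measurable fun y => L y x) ∧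
      (∀ᵐ y ∂ν, ‖L y‖ ≤ D * (1 + η * Module.finrank ℝ X / τ)) ∧
      ∀ x, (1 - (2 * η + 2 * (D * (τ + 2 * η))) * Module.finrank ℝ X) * ‖x‖ ≤
        ∫ y, ‖L y x‖ ∂ν := by
  obtain ⟨π, hπt, hπ⟩ := exists_simpleFunc_dist_le ht ht0 htη
  set μ : Measure X := Measure.addHaar
  set F : X → V := fun x => g (π x) with hF
  have hFm : StronglyMeasurable F := (π.map g).stronglyMeasurable
  obtain ⟨B, hB⟩ := (π.map g).exists_forall_norm_le
  have hπ2 : ∀ x ∈ closedBall (0 : X) 1, ∀ y ∈ closedBall (0 : X) 1,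
      |‖π x - π y‖ - ‖x - y‖| ≤ 2 * η := by
    intro x hx y hy
    have h1 := hπ x hx
    have h2 := hπ y hy
    rw [dist_eq_norm] at h1 h2
    refine (abs_norm_sub_norm_le _ _).trans ?_
    have e : π x - π y - (x - y) = (π x - x) - (π y - y) := by abel
    rw [e]
    linarith [norm_sub_le (π x - x) (π y - y)]
  have hFD : ∀ x ∈ closedBall (0 : X) 1, ∀ y ∈ closedBall (0 : X) 1,
      ‖F x - F y‖ ≤ D * (‖x - y‖ + 2 * η) := fun x hx y hy =>
    (hg _ (hπt x) _ (hπt y)).2.trans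
      (mul_le_mul_of_nonneg_left (by linarith [(abs_le.1 (hπ2 x hx y hy)).2]) hD)
  have hFc : ∀ x ∈ closedBall (0 : X) 1, ∀ y ∈ closedBall (0 : X) 1,
      ‖x - y‖ - 2 * η ≤ ‖F x - F y‖ := fun x hx y hy =>
    le_trans (by linarith [(abs_le.1 (hπ2 x hx y hy)).1]) (hg _ (hπt x) _ (hπt y)).1
  set Φ := ballAverage μ τ F
  have hC0 : 0 ≤ D * (1 + η * Module.finrank ℝ X / τ) := by positivity
  set C : ℝ≥0 := ⟨D * (1 + η * Module.finrank ℝ X / τ), hC0⟩ with hC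
  have hΦ : LipschitzOnWith C Φ (closedBall 0 (1 - τ)) := by
    refine LipschitzOnWith.of_dist_le_mul fun x hx y hy => ?_
    rw [dist_eq_norm, dist_eq_norm]
    refine (norm_ballAverage_sub_le hFm hB hD (by positivity : 0 ≤ 2 * η) hFD hτ hx hy).trans
      (le_of_eq ?_)
    change _ = D * (1 + η * Module.finrank ℝ X / τ) * ‖x - y‖
    congr 3
    field_simp
  have hΦc : ∀ x ∈ closedBall (0 : X) (1 - τ), ∀ y ∈ closedBall (0 : X) (1 - τ),
      ‖x - y‖ - (2 * η + 2 * (D * (τ + 2 * η))) ≤ ‖Φ x - Φ y‖ := fun x hx y hy =>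
    le_norm_ballAverage_sub hFm hB hD hFD hFc hτ hx hy
  -- Since `τ < 1/2`, this ball lies inside the one of radius `1 - τ` where `Φ` is controlled; at
  -- radius `1/2` the factor `n / (2r)` is `n`.
  set K := closedBall (0 : X) (1 / 2)
  have hfin : μ K ≠ ∞ := isBounded_closedBall.measure_lt_top.ne
  have hpos : μ K ≠ 0 := (measure_closedBall_pos _ _ (by norm_num)).ne'
  have hr : (1 / 2 : ℝ) < 1 - τ := by linarith
  refine ⟨ProbabilityTheory.cond μ K,
    ProbabilityTheory.cond_isProbabilityMeasure_of_finite hpos hfin, fderiv ℝ Φ,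
    fun x => measurable_fderiv_apply_const ℝ Φ x, ?_, fun x => ?_⟩
  · rw [ProbabilityTheory.cond]
    refine Measure.ae_smul_measure ?_ _
    exact (ae_restrict_iff' measurableSet_closedBall).2 (ae_of_all _ fun y hy =>
      norm_fderiv_le_of_mem_closedBall hr hΦ hy)
  · have key := le_setIntegral_norm_fderiv (μ := μ) (by norm_num) hr hΦ (by positivity) hΦc x
    rw [ProbabilityTheory.cond, integral_smul_measure, ENNReal.toReal_inv, smul_eq_mul,
      le_inv_mul_iff₀ (ENNReal.toReal_pos hpos hfin)]
    refine le_trans (le_of_eq ?_) key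
    rw [measureReal_def]
    ring

theorem exists_LpUnitInterval_map_of_net (p : ℝ≥0∞) [Fact (1 ≤ p)] (hp : p ≠ ∞) {N : Set X}
    {δ D τ : ℝ} (hδ : 0 < δ) (hN : IsNetInUnitBall δ.toNNReal N) (hD : 0 ≤ D) (hτ : 0 < τ)
    (hτ' : τ < 1 / 2) {f : N → LpUnitInterval p}
    (hf : ∀ x y : N, ‖(x - y : X)‖ ≤ ‖f x - f y‖ ∧ ‖f x - f y‖ ≤ D * ‖(x - y : X)‖) :
    ∃ T : X → LpUnitInterval p, ∀ x y,
      (1 - (4 * δ + 2 * (D * (τ + 4 * δ))) * Module.finrank ℝ X) * ‖x - y‖ ≤ ‖T x - T y‖ ∧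
      ‖T x - T y‖ ≤ D * (1 + 2 * δ * Module.finrank ℝ X / τ) * ‖x - y‖ := by
  obtain ⟨t, htN, htf, ht0, htc⟩ := hN.exists_finite_subset hδ
  have := htf.to_subtype
  set V : Submodule ℝ (LpUnitInterval p) :=
    Submodule.span ℝ (range fun x : t => f ⟨x, htN x.2⟩) with hV
  have : FiniteDimensional ℝ V := FiniteDimensional.span_of_finite ℝ (finite_range _)
  borelize X
  let : MeasurableSpace V := borel V
  have : BorelSpace V := ⟨rfl⟩
  classical
  set g : X → V := fun x =>
    if h : x ∈ t then ⟨f ⟨x, htN h⟩, Submodule.subset_span ⟨⟨x, h⟩, rfl⟩⟩ else 0 with hg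
  have hgt : ∀ x ∈ t, ∀ y ∈ t, ‖x - y‖ ≤ ‖g x - g y‖ ∧ ‖g x - g y‖ ≤ D * ‖x - y‖ := by
    intro x hx y hy
    have h1 : ‖g x - g y‖ = ‖f ⟨x, htN hx⟩ - f ⟨y, htN hy⟩‖ := by
      simp only [hg, hx, hy, dite_true]
      rfl
    rw [h1]
    exact hf ⟨x, htN hx⟩ ⟨y, htN hy⟩
  obtain ⟨ν, hν, L, hL, hLC, hLm⟩ := exists_linear_field htf ht0 (by positivity) hD hτ hτ' htc hgt
  have hlam : IsProbabilityMeasure (volume.restrict (Icc (0 : ℝ) 1)) := ⟨by simp⟩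
  obtain ⟨T, hT⟩ := exists_Lp_prod_of_field hp (rep := linearRep V) measurable_linearRep
    linearRep_sub eLpNorm_linearRep ν hL (by positivity) hLC hLm
  obtain ⟨U⟩ := exists_linearIsometry_LpUnitInterval (p := p)
    (ν.prod (volume.restrict (Icc (0 : ℝ) 1)))
  refine ⟨fun x => U (T x), fun x y => ?_⟩
  rw [← map_sub, U.norm_map]
  convert hT x y using 5; ring

end Extension

/-! ### Choice of constants -/

section Discretization

theorem ofReal_mul_distortion_le_distortion_net (p : ℝ≥0∞) [Fact (1 ≤ p)] (hp : p ≠ ∞) {ε : ℝ}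
    (hε : 0 < ε) (hε1 : ε < 1) {n : ℕ} (hn : 1 ≤ n) {X : Type*} [NormedAddCommGroup X]
    [NormedSpace ℝ X] [FiniteDimensional ℝ X] (hX : Module.finrank ℝ X = n) {δ : ℝ}
    (hδ : δ = 1 / 64 * ε ^ 2 / (n ^ 2 * √n)) {N : Set X} (hN : IsNetInUnitBall δ.toNNReal N) :
    ENNReal.ofReal (1 - ε) * distortion X (LpUnitInterval p) ≤
      distortion N (LpUnitInterval p) := by
  have hn' : (1 : ℝ) ≤ n := by exact_mod_cast hn
  have hr1 : 1 ≤ √(n : ℝ) := Real.one_le_sqrt.2 hn'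
  have hδ0 : 0 < δ := by rw [hδ]; positivity
  have hX1 := distortion_LpUnitInterval_le_sqrt p hn hX
  refine le_sInf ?_
  rintro D ⟨hD1, f, s, hs, hf⟩
  -- A `D` of at least `√n` already exceeds the distortion of `X`.
  rcases le_or_gt (ENNReal.ofReal √n) D with hDn | hDn
  · refine le_trans ?_ (hX1.trans hDn)
    refine mul_le_of_le_one_left' ?_
    exact ENNReal.ofReal_le_one.2 (by linarith)
  lift D to ℝ≥0 using (hDn.trans ENNReal.ofReal_lt_top).ne
  have hD1' : (1 : ℝ) ≤ D := by exact_mod_cast hD1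
  have hDn' : (D : ℝ) ≤ √n := by
    rw [← ENNReal.ofReal_coe_nnreal, ENNReal.ofReal_lt_ofReal_iff (by positivity)] at hDn
    exact hDn.le
  have hs' : (0 : ℝ) < s := by exact_mod_cast hs
  have hf' : ∀ x y : N, ‖(x - y : X)‖ ≤ ‖(s : ℝ)⁻¹ • f x - (s : ℝ)⁻¹ • f y‖ ∧
      ‖(s : ℝ)⁻¹ • f x - (s : ℝ)⁻¹ • f y‖ ≤ D * ‖(x - y : X)‖ := by
    intro x y
    have h := hf x y
    rw [← smul_sub, norm_smul, norm_inv, Real.norm_of_nonneg hs'.le, le_inv_mul_iff₀ hs',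
      inv_mul_le_iff₀ hs', ← dist_eq_norm (f x), ← dist_eq_norm (x : X)]
    rw [edist_nndist, edist_nndist] at h
    have h1 : s * nndist x y ≤ nndist (f x) (f y) := by exact_mod_cast h.1
    have h2 : nndist (f x) (f y) ≤ D * s * nndist x y := by exact_mod_cast h.2
    have h1' : (s : ℝ) * dist x y ≤ dist (f x) (f y) := by exact_mod_cast h1
    have h2' : dist (f x) (f y) ≤ D * s * dist x y := by exact_mod_cast h2
    exact ⟨h1', h2'.trans (le_of_eq (by rw [Subtype.dist_eq]; ring))⟩
  set r := √(n : ℝ) with hr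
  -- Chosen so that the smoothing loss `2Dτn` is at most `ε / 4`; `δ` then makes the upper loss `2δn
  -- / τ` equal to `ε / 4`.
  set τ := ε / (8 * (n * r)) with hτ
  have hτ0 : 0 < τ := by positivity
  have hnr : 1 ≤ n * r := one_le_mul_of_one_le_of_one_le hn' hr1
  have hτ1 : τ < 1 / 2 := by
    rw [hτ, div_lt_iff₀ (by positivity)]
    linarith
  obtain ⟨T, hT⟩ := exists_LpUnitInterval_map_of_net p hp hδ0 hN D.2 hτ0 hτ1 hf'
  rw [hX] at hT
  have hδτ : 2 * δ * n / τ = ε / 4 := by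
    rw [hδ, hτ]
    field_simp
    norm_num
  have hb : (4 * δ + 2 * (D * (τ + 4 * δ))) * n ≤ 3 / 4 * ε := by
    have e1 : 2 * (r * τ) * n = ε / 4 := by
      rw [hτ]; field_simp; norm_num
    have e2 : r * δ * n = 1 / 64 * ε ^ 2 / n := by
      rw [hδ]; field_simp
    have e3 : 1 / 64 * ε ^ 2 / n ≤ 1 / 64 * ε := by
      rw [div_le_iff₀ (by positivity)]
      nlinarith
    have e4 : δ * n ≤ r * δ * n := by
      rw [mul_assoc]
      exact le_mul_of_one_le_left (by positivity) hr1
    calc (4 * δ + 2 * (D * (τ + 4 * δ))) * n ≤ (4 * δ + 2 * (r * (τ + 4 * δ))) * n := by gcongr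
      _ = 4 * (δ * n) + 2 * (r * τ) * n + 8 * (r * δ * n) := by ring
      _ ≤ 3 / 4 * ε := by linarith
  rw [hδτ] at hT
  set b := (4 * δ + 2 * (D * (τ + 4 * δ))) * n with hbdef
  have hb0 : 0 ≤ b := by positivity
  have hm : 0 < 1 - b := by linarith
  have key := distortion_le_ofReal_div hm (by nlinarith : 1 - b ≤ D * (1 + ε / 4)) hT
  calc ENNReal.ofReal (1 - ε) * distortion X (LpUnitInterval p)
      ≤ ENNReal.ofReal (1 - ε) * ENNReal.ofReal (D * (1 + ε / 4) / (1 - b)) := by gcongr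
    _ = ENNReal.ofReal ((1 - ε) * (D * (1 + ε / 4) / (1 - b))) :=
        (ENNReal.ofReal_mul (by linarith)).symm
    _ ≤ ENNReal.ofReal D := by
        refine ENNReal.ofReal_le_ofReal ?_
        rw [mul_div_assoc', div_le_iff₀ hm]
        -- The left side is `1 - 3ε/4 - ε²/4`, hence the target `3/4 * ε` for `b`.
        have : (1 - ε) * (1 + ε / 4) ≤ 1 - b := by nlinarith
        nlinarith
    _ = D := ENNReal.ofReal_coe_nnreal

theorem natCast_rpow_five_halves (n : ℕ) : (n : ℝ) ^ (5 / 2 : ℝ) = n ^ 2 * √n := by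
  rw [show (5 / 2 : ℝ) = 2 + 1 / 2 by norm_num, Real.rpow_add_of_nonneg (by positivity)
    (by norm_num) (by norm_num), Real.sqrt_eq_rpow, Real.rpow_two]

end Discretization

theorem mainTheorem3 :
    ∃ κ : ℝ, 0 < κ ∧
      ∀ (p : ℝ≥0∞) [Fact (1 ≤ p)], p ≠ ∞ →
      ∀ ε : ℝ, 0 < ε → ε < 1 →
      ∀ n : ℕ, 1 ≤ n →
      ∀ (X : Type*) [NormedAddCommGroup X] [NormedSpace ℝ X] [FiniteDimensional ℝ X],
        Module.finrank ℝ X = n →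
        κ * ε ^ 2 / (n : ℝ) ^ (5 / 2 : ℝ) ≤
          discretizationModulus X (LpUnitInterval p) ε := by
  refine ⟨1 / 64, by norm_num, fun p _ hp ε hε hε1 n hn X _ _ _ hX => ?_⟩
  rw [natCast_rpow_five_halves]
  have hn' : (1 : ℝ) ≤ n := by exact_mod_cast hn
  have hr1 : 1 ≤ √(n : ℝ) := Real.one_le_sqrt.2 hn'
  have hden : 1 ≤ (n : ℝ) ^ 2 * √n := one_le_mul_of_one_le_of_one_le (one_le_pow₀ hn') hr1
  refine le_csSup ⟨1, fun δ hδ => hδ.2.1.le⟩ ⟨by positivity, ?_, fun N hN => ?_⟩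
  · rw [div_lt_one (by positivity)]
    nlinarith
  · exact ofReal_mul_distortion_le_distortion_net p hp hε hε1 hn hX rfl hN
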